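/- For a permutation $\sigma$ of $\{0,\dots,n-1\}$ and $x\in\{0,1\}^n$ put $\sigma(x)=(x_{\sigma^{-1}(0)},\dots,x_{\sigma^{-1}(n-1)})$. A $Z_2Z_4$ structure is an involution $\pi$ of the set $\{0,\dots,n-1\}$ (that is, $\pi^2=\mathrm{Id}$; fixed points and $\pi=\mathrm{Id}$ are allowed), and $x*_\pi y = x+y+(x+\pi(x))\cdot(y+\pi(y))$ with coordinatewise addition and multiplication modulo $2$. A code $C\subseteq\{0,1\}^n$ is called $1$-perfect if $|C|=2^n/(n+1)$ and distinct codewords are at Hamming distance at least $3$; extended $1$-perfect if $|C|=2^{n-1}/n$ and distinct codewords are at distance at least $4$; Preparata-like if $|C|=2^n/n^2$ and distinct codewords are at distance at least $6$. Let $\mathrm{Sym}(C)$ be the group of coordinate permutations $\sigma$ with $\sigma(x)\in C$ for all $x\in C$, and let $\mathrm{Sym}_\pi(C)$ be the subgroup of those $\sigma\in\mathrm{Sym}(C)$ with $\sigma(\pi(i))=\pi(\sigma(i))$ for all $i$. Let $C\subseteq\{0,1\}^n$ be a $1$-perfect, extended $1$-perfect, or Preparata-like code of length $n>16$, and let $\pi$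 be a $Z_2Z_4$ structure such that $C$ is closed with respect to $*_\pi$. Then $\mathrm{Sym}(C)=\mathrm{Sym}_\pi(C)$. -/

import Mathlib

namespace Z2Z4

/-- Binary words of length `n`. -/
abbrev Word (n : ℕ) : Type := Fin n → ZMod 2

/-- The action of a coordinate permutation on words:
`σ(x) = (x_{σ⁻¹(0)}, …, x_{σ⁻¹(n-1)})`. -/
def permAct {n : ℕ} (σ : Equiv.Perm (Fin n)) (x : Word n) : Word n :=
  fun i => x (σ.symm i)

/-- A `Z₂Z₄` structure: an involution of the set of coordinates. Fixed points
(self-adjacent coordinates) are allowed, and so is the identity. -/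
def IsStructure {n : ℕ} (π : Equiv.Perm (Fin n)) : Prop :=
  ∀ i, π (π i) = i

/-- The operation `x *_π y = x + y + (x + π(x)) · (y + π(y))`, coordinatewise modulo 2. -/
def starOp {n : ℕ} (π : Equiv.Perm (Fin n)) (x y : Word n) : Word n :=
  x + y + (x + permAct π x) * (y + permAct π y)

/-- `C` is closed with respect to `*_π`. -/
def ClosedUnderStar {n : ℕ} (π : Equiv.Perm (Fin n)) (C : Set (Word n)) : Prop :=
  ∀ x ∈ C, ∀ y ∈ C, starOp π x y ∈ C

/-- Every two distinct codewords are at Hamming distance at least `d`. -/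
def MinDistAtLeast {n : ℕ} (d : ℕ) (C : Set (Word n)) : Prop :=
  ∀ x ∈ C, ∀ y ∈ C, x ≠ y → d ≤ hammingDist x y

/-- A `1`-perfect code: `|C| = 2^n / (n + 1)` and distance at least `3`. -/
def IsOnePerfect {n : ℕ} (C : Set (Word n)) : Prop :=
  C.ncard * (n + 1) = 2 ^ n ∧ MinDistAtLeast 3 C

/-- An extended `1`-perfect code: `|C| = 2^(n-1) / n` and distance at least `4`. -/
def IsExtendedOnePerfect {n : ℕ} (C : Set (Word n)) : Prop :=
  C.ncard * n = 2 ^ (n - 1) ∧ MinDistAtLeast 4 C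

/-- A Preparata-like code: `|C| = 2^n / n^2` and distance at least `6`. -/
def IsPreparataLike {n : ℕ} (C : Set (Word n)) : Prop :=
  C.ncard * n ^ 2 = 2 ^ n ∧ MinDistAtLeast 6 C

/-- The symmetry group `Sym(C)`: all coordinate permutations mapping `C` into `C`. -/
def symGroup {n : ℕ} (C : Set (Word n)) : Subgroup (Equiv.Perm (Fin n)) where
  carrier := {σ | ∀ x ∈ C, permAct σ x ∈ C}
  mul_mem' := fun ha hb x hx => ha _ (hb x hx)
  one_mem' := fun _ hx => hx
  inv_mem' := by
    intro σ hσ x hx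
    have hinj : Function.Injective (permAct σ) := fun a b h => by
      funext i
      simpa [permAct] using congrFun h (σ i)
    have himg : permAct σ '' C = C :=
      Set.eq_of_subset_of_ncard_le (Set.image_subset_iff.2 hσ)
        (Set.ncard_image_of_injective C hinj).ge C.toFinite
    rw [← himg] at hx
    obtain ⟨y, hy, rfl⟩ := hx
    have hyy : permAct σ⁻¹ (permAct σ y) = y := by
      funext i
      exact congrArg y (σ.symm_apply_apply i)
    rwa [hyy]

/-- The group `Sym_π(C)` of `Z₂Z₄`-symmetries: the symmetries of `C` commuting with `π`. -/
def structureSymGroup {n : ℕ} (π : Equiv.Perm (Fin n)) (C : Set (Word n)) :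
    Subgroup (Equiv.Perm (Fin n)) where
  carrier := {σ | σ ∈ symGroup C ∧ ∀ i, σ (π i) = π (σ i)}
  mul_mem' := fun ha hb =>
    ⟨mul_mem ha.1 hb.1, fun i => by simp only [Equiv.Perm.mul_apply, hb.2, ha.2]⟩
  one_mem' := ⟨one_mem _, fun _ => rfl⟩
  inv_mem' := by
    rintro σ ⟨h, hc⟩
    refine ⟨inv_mem h, fun i => ?_⟩
    rw [Equiv.Perm.inv_eq_iff_eq, hc]
    exact congrArg π (σ.apply_symm_apply i).symm

end Z2Z4

/-! A symmetry `σ` of `C` carries closure under `*_π` to closure under the operation of `σπσ⁻¹`, so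
it suffices that `C` is closed for only one structure (`structure_unique`). Suppose `π i ≠ τ i`.
Take codewords `x`, `y` of weight `k` meeting only in `i` and otherwise in general position for `π`
and `τ`. Then `x *_π y` is `x + y`, with coordinates `i` and `π i` flipped if `π i ≠ i`; likewise
for `τ`. The two products are distinct codewords at distance at most 2, a contradiction.

Such words exist because `C` contains zero and has many words of weight `k = 3, 4, 6` through each
coordinate (`HasAvoidingWords`). In a 1-perfect code the words of weight 3 form a Steiner triple
system; an extended code becomes 1-perfect after puncturing. A punctured Preparata-like code, of
length `N = n - 1`, is nearly perfect: counting the words at distance at least 3 from the code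
forces equality in the Johnson bound, so every pair lies in `(N - 3) / 3` words of weight 5,
disjoint outside the pair (`three_mul_card_blocks`). -/

open scoped symmDiff

namespace Z2Z4

/-! ### Sphere packing and minimum weight words, with codewords as finite sets -/

section Codes

variable {ι : Type*} [DecidableEq ι]

/-- Distinct members of `D` have symmetric difference of size at least `d`. -/
def Separated (d : ℕ) (D : Finset (Finset ι)) : Prop :=
  ∀ A ∈ D, ∀ B ∈ D, A ≠ B → d ≤ (A ∆ B).card

lemma card_symmDiff_add (A B : Finset ι) :
    (A ∆ B).card + 2 * (A ∩ B).card = A.card + B.card := by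
  have h : (A ∆ B).card = (A \ B).card + (B \ A).card :=
    Finset.card_union_of_disjoint disjoint_sdiff_sdiff
  have h1 := Finset.card_sdiff_add_card_inter A B
  have h2 := Finset.card_sdiff_add_card_inter B A
  rw [Finset.inter_comm] at h2
  omega

lemma card_symmDiff_triangle (A B C : Finset ι) :
    (A ∆ C).card ≤ (A ∆ B).card + (B ∆ C).card :=
  (Finset.card_le_card (symmDiff_triangle A B C)).trans (Finset.card_union_le _ _)

lemma symmDiff_subset {A B S : Finset ι} (hA : A ⊆ S) (hB : B ⊆ S) : A ∆ B ⊆ S := by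
  intro z hz
  rcases Finset.mem_symmDiff.1 hz with h | h
  · exact hA h.1
  · exact hB h.1

lemma two_mul_choose_two_add (m : ℕ) : 2 * m.choose 2 + m = m * m := by
  rw [Nat.choose_two_right, Nat.two_mul_div_two_of_even (Nat.even_mul_pred_self m)]
  rcases m with _ | m
  · rfl
  · simp only [Nat.add_sub_cancel]
    ring

lemma card_ball (S c : Finset ι) (hc : c ⊆ S) (r : ℕ) :
    (S.powerset.filter fun w => (w ∆ c).card ≤ r).card
      = ∑ k ∈ Finset.range (r + 1), S.card.choose k := by
  have h1 : (S.powerset.filter fun w => (w ∆ c).card ≤ r).card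
      = ((Finset.range (r + 1)).biUnion fun k => Finset.powersetCard k S).card := by
    refine Finset.card_bij' (fun w _ => w ∆ c) (fun w _ => w ∆ c) ?_ ?_ ?_ ?_
    · intro w hw
      simp only [Finset.mem_filter, Finset.mem_powerset, Finset.mem_biUnion, Finset.mem_range,
        Finset.mem_powersetCard] at hw ⊢
      exact ⟨_, by omega, symmDiff_subset hw.1 hc, rfl⟩
    · intro w hw
      simp only [Finset.mem_filter, Finset.mem_powerset, Finset.mem_biUnion, Finset.mem_range,
        Finset.mem_powersetCard] at hw ⊢
      obtain ⟨k, hk, hw, rfl⟩ := hw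
      rw [symmDiff_symmDiff_cancel_right]
      exact ⟨symmDiff_subset hw hc, by omega⟩
    · intro w _
      exact symmDiff_symmDiff_cancel_right _ _
    · intro w _
      exact symmDiff_symmDiff_cancel_right _ _
  rw [h1, Finset.card_biUnion]
  · simp
  · intro a _ b _ hab
    exact Finset.pairwise_disjoint_powersetCard S hab

/-- The words covered by the radius `r` balls around an `r`-error-correcting code. -/
lemma card_covered {S : Finset ι} {D : Finset (Finset ι)} (hS : D ⊆ S.powerset) {r : ℕ}
    (hD : Separated (2 * r + 1) D) :
    (S.powerset.filter fun w => ∃ c ∈ D, (w ∆ c).card ≤ r).card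
      = D.card * ∑ k ∈ Finset.range (r + 1), S.card.choose k := by
  have h1 : (S.powerset.filter fun w => ∃ c ∈ D, (w ∆ c).card ≤ r)
      = D.biUnion fun c => S.powerset.filter fun w => (w ∆ c).card ≤ r := by
    ext w
    simp only [Finset.mem_filter, Finset.mem_biUnion]
    tauto
  rw [h1, Finset.card_biUnion, Finset.sum_congr rfl, Finset.sum_const, smul_eq_mul]
  · exact fun c hc => card_ball S c (Finset.mem_powerset.1 (hS hc)) r
  · intro a ha b hb hab
    refine Finset.disjoint_left.2 fun w hwa hwb => ?_
    have h1 := (Finset.mem_filter.1 hwa).2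
    have h2 := (Finset.mem_filter.1 hwb).2
    have h3 := card_symmDiff_triangle a w b
    have h4 := hD a ha b hb hab
    rw [symmDiff_comm a w] at h3
    omega

/-- In a perfect code containing the zero word every pair lies in a word of weight three. -/
lemma exists_triple {S : Finset ι} {D : Finset (Finset ι)} (hS : D ⊆ S.powerset)
    (hD : Separated 3 D) (hcard : D.card * (S.card + 1) = 2 ^ S.card) (h0 : ∅ ∈ D)
    {a b : ι} (ha : a ∈ S) (hb : b ∈ S) (hab : a ≠ b) :
    ∃ A ∈ D, A.card = 3 ∧ a ∈ A ∧ b ∈ A := by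
  have h1 := card_covered hS (r := 1) hD
  rw [Finset.sum_range_succ, Finset.sum_range_one, Nat.choose_zero_right, Nat.choose_one_right,
    add_comm 1, hcard, ← Finset.card_powerset] at h1
  have h2 : ({a, b} : Finset ι) ∈ S.powerset := by
    simp [Finset.insert_subset_iff, ha, hb]
  -- The radius 1 balls fill the space, so some codeword is within distance 1 of the pair.
  rw [← Finset.eq_of_subset_of_card_le (Finset.filter_subset _ _) h1.ge, Finset.mem_filter] at h2
  obtain ⟨-, A, hA, hw⟩ := h2
  have hp := Finset.card_pair hab
  have h3 := card_symmDiff_add {a, b} A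
  have h4 : ({a, b} ∩ A : Finset ι).card ≤ 2 :=
    (Finset.card_le_card Finset.inter_subset_left).trans hp.le
  have h5 : 3 ≤ A.card := by
    have hne : A ≠ ∅ := by
      rintro rfl
      simp [symmDiff, hp] at hw
    simpa [symmDiff] using hD A hA ∅ h0 hne
  have h6 : ({a, b} : Finset ι) ⊆ A := by
    rw [← Finset.inter_eq_left]
    exact Finset.eq_of_subset_of_card_le Finset.inter_subset_left (by omega)
  have h7 : ({a, b} ∩ A : Finset ι).card = 2 := by rw [Finset.inter_eq_left.2 h6, hp]
  exact ⟨A, hA, by omega, h6 (by simp), h6 (by simp)⟩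

/-- Triples through `i` meet only in `i`, so those meeting `F` number at most `|F|` and cover at
most `2|F|` further points. -/
lemma exists_triple_disjoint {S : Finset ι} {D : Finset (Finset ι)} (hS : D ⊆ S.powerset)
    (hD : Separated 3 D) (hcard : D.card * (S.card + 1) = 2 ^ S.card) (h0 : ∅ ∈ D)
    {i : ι} (hi : i ∈ S) {F : Finset ι} (hF : 2 * F.card + 1 < S.card) (hiF : i ∉ F) :
    ∃ A ∈ D, A.card = 3 ∧ i ∈ A ∧ Disjoint A F := by
  have hex : ∀ f : ι, ∃ A : Finset ι, (A.erase i).card ≤ 2 ∧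
      (f ∈ S → f ≠ i → A ∈ D ∧ A.card = 3 ∧ i ∈ A ∧ f ∈ A) := by
    intro f
    by_cases hf : f ∈ S ∧ f ≠ i
    · obtain ⟨A, hA, h3, h⟩ := exists_triple hS hD hcard h0 hi hf.1 hf.2.symm
      exact ⟨A, by rw [Finset.card_erase_of_mem h.1, h3], fun _ _ => ⟨hA, h3, h⟩⟩
    -- A dummy value where no triple is needed.
    · exact ⟨∅, by simp, fun h h' => (hf ⟨h, h'⟩).elim⟩
  choose T hT2 hT using hex
  have hlt : (insert i (F.biUnion fun f => (T f).erase i)).card < S.card := by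
    have h1 := Finset.card_insert_le i (F.biUnion fun f => (T f).erase i)
    have h2 : (F.biUnion fun f => (T f).erase i).card ≤ F.card * 2 :=
      Finset.card_biUnion_le_card_mul _ _ _ fun f _ => hT2 f
    omega
  obtain ⟨j, hjS, hj⟩ := Finset.exists_mem_notMem_of_card_lt_card hlt
  simp only [Finset.mem_insert, Finset.mem_biUnion, not_or, not_exists, not_and, Finset.mem_erase] at hj
  obtain ⟨hA, hA3, hiA, hjA⟩ := hT j hjS hj.1
  refine ⟨T j, hA, hA3, hiA, Finset.disjoint_left.2 fun f hfj hfF => ?_⟩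
  have hfi : f ≠ i := fun h => hiF (h ▸ hfF)
  obtain ⟨hB, hB3, hiB, hfB⟩ := hT f (Finset.mem_powerset.1 (hS hA) hfj) hfi
  have hne : T j ≠ T f := fun h => hj.2 f hfF hj.1 (h ▸ hjA)
  have h1 := hD _ hA _ hB hne
  have h2 := card_symmDiff_add (T j) (T f)
  have h3 : ({i, f} : Finset ι) ⊆ T j ∩ T f := by
    simp [Finset.insert_subset_iff, *]
  have h4 := Finset.card_le_card h3
  rw [Finset.card_pair hfi.symm] at h4
  omega

/-! ### Equality in the Johnson bound for nearly perfect codes -/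

/-- The members of `D` of size five containing `p`. -/
def blocks (D : Finset (Finset ι)) (p : Finset ι) : Finset (Finset ι) :=
  D.filter fun e => e.card = 5 ∧ p ⊆ e

/-- The three-element subsets of `S` contained in no five-element member of `D`. -/
def openTriples (S : Finset ι) (D : Finset (Finset ι)) : Finset (Finset ι) :=
  (Finset.powersetCard 3 S).filter fun t => ∀ e ∈ D, e.card = 5 → ¬ t ⊆ e

lemma eq_of_mem_blocks {D : Finset (Finset ι)} (hD : Separated 5 D) {p e f : Finset ι} {z : ι}
    (hp : p.card = 2) (he : e ∈ blocks D p) (hf : f ∈ blocks D p) (hz : z ∉ p) (hze : z ∈ e)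
    (hzf : z ∈ f) : e = f := by
  by_contra hne
  simp only [blocks, Finset.mem_filter] at he hf
  have h1 := hD e he.1 f hf.1 hne
  have h2 := card_symmDiff_add e f
  have h3 : insert z p ⊆ e ∩ f :=
    Finset.insert_subset (Finset.mem_inter.2 ⟨hze, hzf⟩) (Finset.subset_inter he.2.2 hf.2.2)
  have h4 := Finset.card_le_card h3
  rw [Finset.card_insert_of_notMem hz] at h4
  omega

lemma card_biUnion_blocks {D : Finset (Finset ι)} (hD : Separated 5 D) {p : Finset ι}
    (hp : p.card = 2) : ((blocks D p).biUnion fun e => e \ p).card = 3 * (blocks D p).card := by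
  rw [Finset.card_biUnion, Finset.sum_congr rfl (g := fun _ => 3)]
  · rw [Finset.sum_const, smul_eq_mul, mul_comm]
  · intro e he
    simp only [blocks, Finset.mem_filter] at he
    rw [Finset.card_sdiff_of_subset he.2.2]
    omega
  · intro e he f hf hne
    refine Finset.disjoint_left.2 fun z hze hzf => hne ?_
    rw [Finset.mem_sdiff] at hze hzf
    exact eq_of_mem_blocks hD hp he hf hze.2 hze.1 hzf.1

lemma biUnion_blocks_subset {S : Finset ι} {D : Finset (Finset ι)} (hS : D ⊆ S.powerset)
    (p : Finset ι) : ((blocks D p).biUnion fun e => e \ p) ⊆ S \ p := by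
  refine Finset.biUnion_subset.2 fun e he => Finset.sdiff_subset_sdiff ?_ le_rfl
  exact Finset.mem_powerset.1 (hS (Finset.mem_filter.1 he).1)

lemma three_mul_card_blocks_le {S : Finset ι} {D : Finset (Finset ι)} (hS : D ⊆ S.powerset)
    (hD : Separated 5 D) {p : Finset ι} (hp : p ∈ Finset.powersetCard 2 S) :
    3 * (blocks D p).card + 2 ≤ S.card := by
  rw [Finset.mem_powersetCard] at hp
  have h := Finset.card_le_card (biUnion_blocks_subset hS p)
  have h2 := Finset.card_le_card hp.1
  rw [card_biUnion_blocks hD hp.2, Finset.card_sdiff_of_subset hp.1] at h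
  omega

lemma card_le_openTriples {S : Finset ι} {D : Finset (Finset ι)} (hS : D ⊆ S.powerset)
    (hD : Separated 5 D) {p : Finset ι} (hp : p ∈ Finset.powersetCard 2 S) :
    S.card ≤ ((openTriples S D).filter (p ⊆ ·)).card + 3 * (blocks D p).card + 2 := by
  rw [Finset.mem_powersetCard] at hp
  have h1 : ((S \ p) \ (blocks D p).biUnion fun e => e \ p).card
      ≤ ((openTriples S D).filter (p ⊆ ·)).card := by
    refine Finset.card_le_card_of_injOn (fun z => insert z p) ?_ ?_
    · intro z hz
      simp only [Finset.mem_coe, Finset.mem_sdiff, Finset.mem_biUnion, not_exists, not_and,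
        blocks, Finset.mem_filter, openTriples, Finset.mem_powersetCard] at hz ⊢
      refine ⟨⟨⟨Finset.insert_subset hz.1.1 hp.1, ?_⟩, fun e he h5 hsub => ?_⟩,
        Finset.subset_insert _ _⟩
      · rw [Finset.card_insert_of_notMem hz.1.2, hp.2]
      · rw [Finset.insert_subset_iff] at hsub
        exact hz.2 e ⟨he, h5, hsub.2⟩ hsub.1 hz.1.2
    · intro z hz w hw hzw
      simp only [Finset.mem_coe, Finset.mem_sdiff] at hz hw
      have : z ∈ insert w p := by
        have hzw' : insert z p = insert w p := hzw
        rw [← hzw']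
        exact Finset.mem_insert_self _ _
      exact (Finset.mem_insert.1 this).resolve_right hz.1.2
  rw [Finset.card_sdiff_of_subset (biUnion_blocks_subset hS p),
    Finset.card_sdiff_of_subset hp.1, card_biUnion_blocks hD hp.2] at h1
  omega

/-- Blocks through `p` use up the other `|S| - 2` points three at a time, and `|S| - 2` is not
divisible by 3. -/
lemma one_le_openTriples {S : Finset ι} {D : Finset (Finset ι)} (hS : D ⊆ S.powerset)
    (hD : Separated 5 D) (h3 : ¬ 3 ∣ S.card + 1) {p : Finset ι}
    (hp : p ∈ Finset.powersetCard 2 S) :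
    1 ≤ ((openTriples S D).filter (p ⊆ ·)).card := by
  have h1 := card_le_openTriples hS hD hp
  have h2 := three_mul_card_blocks_le hS hD hp
  omega

lemma sum_openTriples (S : Finset ι) (D : Finset (Finset ι)) :
    ∑ p ∈ Finset.powersetCard 2 S, ((openTriples S D).filter (p ⊆ ·)).card
      = 3 * (openTriples S D).card := by
  have h := Finset.sum_card_bipartiteAbove_eq_sum_card_bipartiteBelow
    (s := Finset.powersetCard 2 S) (t := openTriples S D) (r := fun p t => p ⊆ t)
  simp only [Finset.bipartiteAbove, Finset.bipartiteBelow] at h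
  rw [h, Finset.sum_congr rfl (g := fun _ => 3)]
  · rw [Finset.sum_const, smul_eq_mul, mul_comm]
  · intro t ht
    have ht' := Finset.mem_powersetCard.1 (Finset.mem_filter.1 ht).1
    have : (Finset.powersetCard 2 S).filter (· ⊆ t) = Finset.powersetCard 2 t := by
      ext p
      simp only [Finset.mem_filter, Finset.mem_powersetCard]
      exact ⟨fun h => ⟨h.2, h.1.2⟩, fun h => ⟨⟨h.1.trans ht'.1, h.2⟩, h.1⟩⟩
    rw [this, Finset.card_powersetCard, ht'.2]
    rfl

lemma choose_two_le_openTriples {S : Finset ι} {D : Finset (Finset ι)} (hS : D ⊆ S.powerset)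
    (hD : Separated 5 D) (h3 : ¬ 3 ∣ S.card + 1) :
    S.card.choose 2 ≤ 3 * (openTriples S D).card := by
  rw [← sum_openTriples, ← Finset.card_powersetCard, Finset.card_eq_sum_ones]
  exact Finset.sum_le_sum fun p hp => one_le_openTriples hS hD h3 hp

/-- The words at distance at least three from the whole code. -/
def deepWords (S : Finset ι) (D : Finset (Finset ι)) : Finset (Finset ι) :=
  S.powerset.filter fun w => ∀ c ∈ D, 3 ≤ (w ∆ c).card

lemma two_mul_card_deepWords {S : Finset ι} {D : Finset (Finset ι)} (hS : D ⊆ S.powerset)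
    (hD : Separated 5 D) (hcard : D.card * (S.card + 1) ^ 2 = 2 ^ (S.card + 1)) :
    2 * (deepWords S D).card + D.card = D.card * S.card := by
  have h1 := card_covered hS (r := 2) hD
  have h2 := Finset.card_filter_add_card_filter_not (s := S.powerset)
    (fun w => ∃ c ∈ D, (w ∆ c).card ≤ 2)
  have h3 : (S.powerset.filter fun w => ¬ ∃ c ∈ D, (w ∆ c).card ≤ 2) = deepWords S D := by
    refine Finset.filter_congr fun w _ => ?_
    simp only [not_exists, not_and, not_le]
    rfl
  rw [h3, h1, Finset.card_powerset, Finset.sum_range_succ, Finset.sum_range_succ,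
    Finset.sum_range_one, Nat.choose_zero_right, Nat.choose_one_right] at h2
  have h4 := two_mul_choose_two_add S.card
  rw [pow_succ 2, ← h2] at hcard
  nlinarith

/-- Two codewords at distance 3 from `w` are at least 5 apart, so their difference sets from `w` are
disjoint triples. -/
lemma three_mul_card_near_le {S : Finset ι} {D : Finset (Finset ι)} (hS : D ⊆ S.powerset)
    (hD : Separated 5 D) {w : Finset ι} (hw : w ⊆ S) :
    3 * (D.filter fun c => (w ∆ c).card = 3).card ≤ S.card := by
  have h1 : ((D.filter fun c => (w ∆ c).card = 3).biUnion fun c => w ∆ c).card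
      = 3 * (D.filter fun c => (w ∆ c).card = 3).card := by
    rw [Finset.card_biUnion, Finset.sum_congr rfl (g := fun _ => 3)]
    · rw [Finset.sum_const, smul_eq_mul, mul_comm]
    · exact fun c hc => (Finset.mem_filter.1 hc).2
    · intro a ha b hb hab
      rw [Finset.mem_coe, Finset.mem_filter] at ha hb
      have h := hD a ha.1 b hb.1 hab
      have h2 := card_symmDiff_add (w ∆ a) (w ∆ b)
      rw [symmDiff_symmDiff_symmDiff_comm, symmDiff_self, bot_symmDiff] at h2
      change Disjoint (w ∆ a) (w ∆ b)
      rw [Finset.disjoint_iff_inter_eq_empty, ← Finset.card_eq_zero]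
      omega
  rw [← h1]
  refine Finset.card_le_card (Finset.biUnion_subset.2 fun c hc => ?_)
  exact symmDiff_subset hw (Finset.mem_powerset.1 (hS (Finset.mem_filter.1 hc).1))

/-- A triple is within distance 2 of a word of weight at least 5 only if that word has weight 5 and
contains it. Hence adding `c` to an open triple of the translated code gives a deep word. -/
lemma openTriples_translate_le {S : Finset ι} {D : Finset (Finset ι)} (hS : D ⊆ S.powerset)
    (hD : Separated 5 D) {c : Finset ι} (hc : c ∈ D) :
    (openTriples S (D.image (c ∆ ·))).card
      ≤ ((deepWords S D).filter fun w => (w ∆ c).card = 3).card := by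
  have hcS := Finset.mem_powerset.1 (hS hc)
  refine Finset.card_le_card_of_injOn (fun t => c ∆ t) ?_ ?_
  · intro t ht
    simp only [openTriples, deepWords, Finset.mem_coe, Finset.mem_filter, Finset.mem_powersetCard,
      Finset.mem_powerset, Finset.forall_mem_image] at ht ⊢
    have hcan : (c ∆ t) ∆ c = t := by rw [symmDiff_comm, symmDiff_symmDiff_cancel_left]
    refine ⟨⟨symmDiff_subset hcS ht.1.1, fun d hd => ?_⟩, by rw [hcan, ht.1.2]⟩
    by_cases hdc : d = c
    · rw [hdc, hcan, ht.1.2]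
    have h1 := hD c hc d hd (Ne.symm hdc)
    have h2 := ht.2 hd
    have h3 := card_symmDiff_add t (c ∆ d)
    have h4 : (c ∆ t) ∆ d = t ∆ (c ∆ d) := by
      rw [symmDiff_comm c t, symmDiff_assoc]
    rw [h4]
    have h5 : (t ∩ (c ∆ d)).card ≤ t.card := Finset.card_le_card Finset.inter_subset_left
    by_contra! hlt
    refine h2 (by omega) ?_
    rw [← Finset.inter_eq_left]
    exact Finset.eq_of_subset_of_card_le Finset.inter_subset_left (by omega)
  · exact fun s _ t _ h => symmDiff_right_injective c h

lemma separated_translate {d : ℕ} {D : Finset (Finset ι)} (hD : Separated d D) (c : Finset ι) :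
    Separated d (D.image (c ∆ ·)) := by
  simp only [Separated, Finset.forall_mem_image]
  intro a ha b hb hab
  rw [symmDiff_symmDiff_symmDiff_comm, symmDiff_self, bot_symmDiff]
  exact hD a ha b hb fun h => hab (h ▸ rfl)

lemma three_mul_openTriples_le {S : Finset ι} {D : Finset (Finset ι)} (hS : D ⊆ S.powerset)
    (hD : Separated 5 D) (h3 : ¬ 3 ∣ S.card + 1)
    (hcard : D.card * (S.card + 1) ^ 2 = 2 ^ (S.card + 1)) (h0 : ∅ ∈ D) :
    3 * (openTriples S D).card ≤ S.card.choose 2 := by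
  have hU : ∀ c ∈ D, (openTriples S (D.image (c ∆ ·))).card
      ≤ ((deepWords S D).filter fun w => (w ∆ c).card = 3).card :=
    fun c hc => openTriples_translate_le hS hD hc
  have hlow : ∀ c ∈ D, S.card.choose 2
      ≤ 3 * ((deepWords S D).filter fun w => (w ∆ c).card = 3).card := by
    intro c hc
    have hsub : D.image (c ∆ ·) ⊆ S.powerset := Finset.image_subset_iff.2 fun d hd =>
      Finset.mem_powerset.2
        (symmDiff_subset (Finset.mem_powerset.1 (hS hc)) (Finset.mem_powerset.1 (hS hd)))
    exact (choose_two_le_openTriples hsub (separated_translate hD c) h3).trans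
      (Nat.mul_le_mul_left 3 (hU c hc))
  -- Counted from the other side: each of the `|D| (N - 1) / 2` deep words has at most `N / 3`
  -- codewords at distance 3, which matches the lower bound exactly.
  have hsum : ∑ c ∈ D, 3 * ((deepWords S D).filter fun w => (w ∆ c).card = 3).card
      ≤ ∑ c ∈ D, S.card.choose 2 := by
    have h := Finset.sum_card_bipartiteAbove_eq_sum_card_bipartiteBelow
      (s := D) (t := deepWords S D) (r := fun c w => (w ∆ c).card = 3)
    simp only [Finset.bipartiteAbove, Finset.bipartiteBelow] at h
    rw [← Finset.mul_sum, h, Finset.mul_sum, Finset.sum_const, smul_eq_mul]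
    have h1 : ∑ w ∈ deepWords S D, 3 * (D.filter fun c => (w ∆ c).card = 3).card
        ≤ (deepWords S D).card * S.card := by
      rw [← smul_eq_mul, ← Finset.sum_const]
      exact Finset.sum_le_sum fun w hw => three_mul_card_near_le hS hD
        (Finset.mem_powerset.1 (Finset.mem_filter.1 hw).1)
    have h2 := two_mul_card_deepWords hS hD hcard
    have h4 := two_mul_choose_two_add S.card
    nlinarith
  have heq := (Finset.sum_eq_sum_iff_of_le hlow).1 ((Finset.sum_le_sum hlow).antisymm hsum) ∅ h0
  have h := hU ∅ h0
  have himg : D.image ((∅ : Finset ι) ∆ ·) = D := by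
    have : ((∅ : Finset ι) ∆ ·) = id := funext fun x => bot_symmDiff x
    rw [this, Finset.image_id]
  rw [himg] at h
  omega

/-- Equality in the Johnson bound: every pair lies in exactly `(N - 3) / 3` words of weight five
of a nearly perfect code of length `N` containing the zero word. -/
lemma three_mul_card_blocks {S : Finset ι} {D : Finset (Finset ι)} (hS : D ⊆ S.powerset)
    (hD : Separated 5 D) (h3 : ¬ 3 ∣ S.card + 1)
    (hcard : D.card * (S.card + 1) ^ 2 = 2 ^ (S.card + 1)) (h0 : ∅ ∈ D) {p : Finset ι}
    (hp : p ∈ Finset.powersetCard 2 S) : 3 * (blocks D p).card + 3 = S.card := by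
  have hle := three_mul_openTriples_le hS hD h3 hcard h0
  rw [← sum_openTriples, ← Finset.card_powersetCard, Finset.card_eq_sum_ones] at hle
  have hlow : ∀ p ∈ Finset.powersetCard 2 S, 1 ≤ ((openTriples S D).filter (p ⊆ ·)).card :=
    fun p hp => one_le_openTriples hS hD h3 hp
  -- Each pair lies in exactly one open triple, leaving one point outside `p` and its blocks.
  have heq := (Finset.sum_eq_sum_iff_of_le hlow).1 ((Finset.sum_le_sum hlow).antisymm hle) p hp
  have h1 := card_le_openTriples hS hD hp
  have h2 := three_mul_card_blocks_le hS hD hp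
  omega

lemma exists_block_disjoint {D : Finset (Finset ι)} (hD : Separated 5 D) {p F : Finset ι}
    (hp : p.card = 2) (hpF : Disjoint p F) (hF : F.card < (blocks D p).card) :
    ∃ A ∈ D, A.card = 5 ∧ p ⊆ A ∧ Disjoint A F := by
  by_contra! hno
  have hex : ∀ e : Finset ι, e ∈ blocks D p → ∃ f ∈ F, f ∈ e := by
    intro e he
    simp only [blocks, Finset.mem_filter] at he
    obtain ⟨f, hfe, hfF⟩ := Finset.not_disjoint_iff.1 (hno e he.1 he.2.1 he.2.2)
    exact ⟨f, hfF, hfe⟩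
  have : Nonempty ι := ⟨(Finset.card_pos.1 (by omega : 0 < p.card)).choose⟩
  choose! g hgF hg using hex
  refine hF.not_ge (Finset.card_le_card_of_injOn g hgF fun e he f hf hef => ?_)
  have hz : g e ∉ p := fun h => Finset.disjoint_left.1 hpF h (hgF e he)
  refine eq_of_mem_blocks hD hp he hf hz (hg e he) ?_
  rw [hef]
  exact hg f hf

end Codes

end Z2Z4

/-! ### Puncturing a coordinate -/

namespace Z2Z4

section Puncture

variable {ι : Type*} [DecidableEq ι]

lemma erase_symmDiff_erase (A B : Finset ι) (i : ι) :
    A.erase i ∆ B.erase i = (A ∆ B).erase i := by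
  ext z
  simp only [Finset.mem_symmDiff, Finset.mem_erase]
  tauto

lemma le_card_erase_symmDiff {d : ℕ} {E : Finset (Finset ι)} (hE : Separated (d + 1) E)
    {A B : Finset ι} (hA : A ∈ E) (hB : B ∈ E) (hAB : A ≠ B) (i : ι) :
    d ≤ (A.erase i ∆ B.erase i).card := by
  have h1 := hE A hA B hB hAB
  have h2 := Finset.pred_card_le_card_erase (s := A ∆ B) (a := i)
  rw [erase_symmDiff_erase]
  omega

lemma separated_puncture {d : ℕ} {E : Finset (Finset ι)} (hE : Separated (d + 1) E) (i : ι) :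
    Separated d (E.image (·.erase i)) := by
  simp only [Separated, Finset.forall_mem_image]
  exact fun A hA B hB h => le_card_erase_symmDiff hE hA hB (fun h' => h (h' ▸ rfl)) i

lemma card_puncture {d : ℕ} {E : Finset (Finset ι)} (hE : Separated (d + 2) E) (i : ι) :
    (E.image (·.erase i)).card = E.card := by
  refine Finset.card_image_of_injOn fun A hA B hB h => ?_
  by_contra hAB
  have h1 := le_card_erase_symmDiff hE hA hB hAB i
  have h2 : A.erase i = B.erase i := h
  rw [h2, symmDiff_self] at h1
  simp at h1

/-- A word of weight `d + 1` in the code, from a word of weight `d` in the punctured code. -/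
lemma lift_puncture {d : ℕ} {E : Finset (Finset ι)} (hE : Separated (d + 1) E) (h0 : ∅ ∈ E)
    {j : ι} {A : Finset ι} (hA : A ∈ E.image (·.erase j)) (hAd : A.card = d) (hd : 0 < d) :
    insert j A ∈ E ∧ (insert j A).card = d + 1 := by
  obtain ⟨B, hB, rfl⟩ := Finset.mem_image.1 hA
  have hne : B ≠ ∅ := by
    rintro rfl
    simp at hAd
    omega
  have h1 : d + 1 ≤ B.card := by simpa [symmDiff] using hE B hB ∅ h0 hne
  have hj : j ∈ B := by
    by_contra hj
    rw [Finset.erase_eq_of_notMem hj] at hAd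
    omega
  have h2 := Finset.card_erase_of_mem hj
  rw [Finset.insert_erase hj]
  exact ⟨hB, by omega⟩

end Puncture

/-! ### Avoiding words in the three families, and supports of words -/

section Supports

variable {n : ℕ}

/-- Every coordinate `i` lies in a word of weight `k` meeting a given small set away from `i`
nowhere. -/
def HasAvoidingWords (k : ℕ) (E : Finset (Finset (Fin n))) : Prop :=
  ∀ (i : Fin n) (F : Finset (Fin n)), i ∉ F → F.card + 1 ≤ 3 * k →
    ∃ A ∈ E, A.card = k ∧ i ∈ A ∧ Disjoint A F

lemma puncture_subset (E : Finset (Finset (Fin n))) (j : Fin n) :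
    E.image (·.erase j) ⊆ (Finset.univ.erase j).powerset := by
  refine Finset.image_subset_iff.2 fun A _ => Finset.mem_powerset.2 ?_
  exact Finset.erase_subset_erase j (Finset.subset_univ A)

lemma empty_mem_puncture {E : Finset (Finset (Fin n))} (h0 : ∅ ∈ E) (j : Fin n) :
    ∅ ∈ E.image (·.erase j) :=
  Finset.mem_image.2 ⟨∅, h0, Finset.erase_empty j⟩

lemma exists_notMem {F : Finset (Fin n)} (h : F.card < n) : ∃ j, j ∉ F := by
  obtain ⟨j, -, hj⟩ := Finset.exists_mem_notMem_of_card_lt_card (s := F) (t := Finset.univ)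
    (by simpa using h)
  exact ⟨j, hj⟩

lemma exists_eq_two_pow {a m k : ℕ} (h : a * m = 2 ^ k) : ∃ r, m = 2 ^ r := by
  obtain ⟨r, -, hr⟩ := (Nat.dvd_prime_pow Nat.prime_two).1 (Dvd.intro_left a h)
  exact ⟨r, hr⟩

lemma five_le_of_lt_two_pow {r : ℕ} (h : 16 < 2 ^ r) : 5 ≤ r :=
  (Nat.pow_lt_pow_iff_right (by norm_num : 1 < 2)).1 (by simpa using h : 2 ^ 4 < 2 ^ r)

lemma hasAvoidingWords_of_perfect (hn : 16 < n) {E : Finset (Finset (Fin n))} (h0 : ∅ ∈ E)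
    (hcard : E.card * (n + 1) = 2 ^ n) (hE : Separated 3 E) : HasAvoidingWords 3 E := by
  intro i F hi hF
  obtain ⟨r, hr⟩ := exists_eq_two_pow hcard
  have h5 : 2 ^ 5 ≤ 2 ^ r :=
    Nat.pow_le_pow_right (by norm_num) (five_le_of_lt_two_pow (by omega))
  refine exists_triple_disjoint (S := Finset.univ) (by simp) hE (by simpa using hcard) h0
    (Finset.mem_univ i) ?_ hi
  rw [Finset.card_univ, Fintype.card_fin]
  omega

lemma hasAvoidingWords_of_extended (hn : 16 < n) {E : Finset (Finset (Fin n))} (h0 : ∅ ∈ E)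
    (hcard : E.card * n = 2 ^ (n - 1)) (hE : Separated 4 E) : HasAvoidingWords 4 E := by
  intro i F hi hF
  obtain ⟨r, hr⟩ := exists_eq_two_pow hcard
  have h5 : 2 ^ 5 ≤ 2 ^ r :=
    Nat.pow_le_pow_right (by norm_num) (five_le_of_lt_two_pow (by omega))
  have hc := Finset.card_insert_le i F
  obtain ⟨j, hj⟩ := exists_notMem (F := insert i F) (by omega)
  rw [Finset.mem_insert, not_or] at hj
  have hS : (Finset.univ.erase j).card = n - 1 := by simp
  have hcard' : (E.image (·.erase j)).card * ((Finset.univ.erase j).card + 1)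
      = 2 ^ (Finset.univ.erase j).card := by
    rw [card_puncture (d := 2) hE, hS, ← hcard]
    congr 1
    omega
  obtain ⟨A, hA, hA3, hiA, hAF⟩ := exists_triple_disjoint (puncture_subset E j)
    (separated_puncture hE j) hcard' (empty_mem_puncture h0 j) (i := i) (F := F)
    (by simp [Ne.symm hj.1]) (by omega) hi
  have h := lift_puncture hE h0 hA hA3 (by norm_num)
  exact ⟨_, h.1, h.2, Finset.mem_insert_of_mem hiA, Finset.disjoint_insert_left.2 ⟨hj.2, hAF⟩⟩

lemma hasAvoidingWords_of_preparata (hn : 16 < n) {E : Finset (Finset (Fin n))} (h0 : ∅ ∈ E)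
    (hcard : E.card * n ^ 2 = 2 ^ n) (hE : Separated 6 E) : HasAvoidingWords 6 E := by
  intro i F hi hF
  obtain ⟨r, hr⟩ := exists_eq_two_pow (a := E.card * n) (m := n) (by rw [← hcard]; ring)
  have hr5 := five_le_of_lt_two_pow (r := r) (by omega)
  have h5 : 2 ^ 5 ≤ 2 ^ r := Nat.pow_le_pow_right (by norm_num) hr5
  have h3 : ¬ 3 ∣ n := by
    rw [hr]
    intro h
    have := Nat.Prime.dvd_of_dvd_pow Nat.prime_three h
    omega
  have hc := Finset.card_insert_le i F
  obtain ⟨j, hj⟩ := exists_notMem (F := insert i F) (by omega)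
  have hc' := Finset.card_insert_le j (insert i F)
  obtain ⟨b, hb⟩ := exists_notMem (F := insert j (insert i F)) (by omega)
  simp only [Finset.mem_insert, not_or] at hj hb
  have hS : (Finset.univ.erase j).card + 1 = n := by
    rw [Finset.card_erase_of_mem (Finset.mem_univ j), Finset.card_univ, Fintype.card_fin]
    omega
  have hp : ({i, b} : Finset (Fin n)) ∈ Finset.powersetCard 2 (Finset.univ.erase j) := by
    rw [Finset.mem_powersetCard]
    refine ⟨?_, Finset.card_pair (Ne.symm hb.2.1)⟩
    simp [Finset.insert_subset_iff, hb.1, Ne.symm hj.1]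
  have hb3 := three_mul_card_blocks (puncture_subset E j) (separated_puncture hE j)
    (by rwa [hS]) (by rw [hS, card_puncture (d := 4) hE, hcard]) (empty_mem_puncture h0 j) hp
  -- Length 32 is impossible, since `3 * b + 3 = 31` has no solution. From 64 on a pair has at least
  -- 20 blocks, more than the at most 17 points of `F`.
  have hbig : 64 ≤ n := by
    rcases hr5.eq_or_lt with h | h
    · subst h
      omega
    · rw [hr]
      exact Nat.pow_le_pow_right (n := 2) (by norm_num) h
  obtain ⟨A, hA, hA5, hpA, hAF⟩ := exists_block_disjoint (separated_puncture hE j)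
    (Finset.mem_powersetCard.1 hp).2 (F := F) (by simp [hi, hb.2.2]) (by omega)
  have h := lift_puncture hE h0 hA hA5 (by norm_num)
  exact ⟨_, h.1, h.2, Finset.mem_insert_of_mem (hpA (by simp)),
    Finset.disjoint_insert_left.2 ⟨hj.2, hAF⟩⟩

/-- The word with support `A`. -/
def word (A : Finset (Fin n)) : Word n := fun i => if i ∈ A then 1 else 0

lemma word_apply_ne_zero {A : Finset (Fin n)} {i : Fin n} : word A i ≠ 0 ↔ i ∈ A := by
  simp [word]

lemma word_injective : Function.Injective (word (n := n)) := fun A B h => by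
  ext i
  rw [← word_apply_ne_zero, h, word_apply_ne_zero]

lemma word_surjective : Function.Surjective (word (n := n)) := fun x => by
  refine ⟨Finset.univ.filter fun i => x i = 1, funext fun i => ?_⟩
  rcases (by decide : ∀ a : ZMod 2, a = 0 ∨ a = 1) (x i) with h | h <;> simp [word, h]

lemma hammingDist_word (A B : Finset (Fin n)) : hammingDist (word A) (word B) = (A ∆ B).card := by
  unfold hammingDist
  congr 1
  ext i
  rw [Finset.mem_filter]
  by_cases hA : i ∈ A <;> by_cases hB : i ∈ B <;> simp [word, Finset.mem_symmDiff, hA, hB]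

open Classical in
/-- The supports of the codewords. -/
noncomputable def supports (C : Set (Word n)) : Finset (Finset (Fin n)) :=
  Finset.univ.filter fun A => word A ∈ C

lemma mem_supports {C : Set (Word n)} {A : Finset (Fin n)} : A ∈ supports C ↔ word A ∈ C := by
  simp [supports]

lemma card_supports (C : Set (Word n)) : (supports C).card = C.ncard := by
  have h : word '' (supports C : Set (Finset (Fin n))) = C := by
    ext x
    constructor
    · rintro ⟨A, hA, rfl⟩
      exact mem_supports.1 hA
    · intro hx
      obtain ⟨A, rfl⟩ := word_surjective x
      exact ⟨A, mem_supports.2 hx, rfl⟩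
  rw [← Set.ncard_coe_finset, ← Set.ncard_image_of_injective _ word_injective, h]

lemma separated_supports {d : ℕ} {C : Set (Word n)} (hC : MinDistAtLeast d C) :
    Separated d (supports C) := fun A hA B hB hAB => by
  rw [← hammingDist_word]
  exact hC _ (mem_supports.1 hA) _ (mem_supports.1 hB) (word_injective.ne hAB)

end Supports

/-! ### Uniqueness of the structure -/

section Star

variable {n : ℕ} {π τ : Equiv.Perm (Fin n)} {C : Set (Word n)}

lemma zero_mem_of_closed (hπ : IsStructure π) (hC : ClosedUnderStar π C) (hne : C.Nonempty) :
    (0 : Word n) ∈ C := by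
  obtain ⟨x, hx⟩ := hne
  -- `x * x = x + π(x)` is fixed by `π`, so its own square is zero.
  have h1 := hC _ (hC x hx x hx) _ (hC x hx x hx)
  convert h1 using 1
  funext i
  have hs : π.symm i = π i := by rw [Equiv.symm_apply_eq, hπ]
  simp only [starOp, permAct, Pi.add_apply, Pi.mul_apply, Pi.zero_apply, hs]
  have hss : π.symm (π i) = i := π.symm_apply_apply i
  rw [hss]
  generalize x i = a
  generalize x (π i) = b
  revert a b
  decide

lemma starOp_conj (σ : Equiv.Perm (Fin n)) (x y : Word n) :
    starOp (σ * π * σ⁻¹) x y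
      = permAct σ (starOp π (permAct σ⁻¹ x) (permAct σ⁻¹ y)) := by
  funext i
  have h : σ⁻¹.symm (σ.symm i) = i := σ.apply_symm_apply i
  simp only [starOp, permAct, Pi.add_apply, Pi.mul_apply, h]
  rfl

/-- Two words meeting only in `i`, and otherwise in general position with respect to `π`. -/
lemma starOp_word_apply (hπ : IsStructure π) {A B : Finset (Fin n)} {i : Fin n} (hiA : i ∈ A)
    (hiB : i ∈ B) (hA : π i ∈ A → π i = i) (hB : π i ∈ B → π i = i)
    (hAB : ∀ z ∈ B, z ≠ i → z ∉ A ∧ π z ∉ A) (z : Fin n) :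
    starOp π (word A) (word B) z
      = word A z + word B z + if π i ≠ i ∧ (z = i ∨ z = π i) then 1 else 0 := by
  have hs : π.symm z = π z := by rw [Equiv.symm_apply_eq, hπ]
  simp only [starOp, permAct, Pi.add_apply, Pi.mul_apply, hs]
  congr 1
  by_cases hfix : π i = i
  · rw [if_neg (by simp [hfix])]
    by_cases hz : z = i
    · rw [hz, hfix, CharTwo.add_self_eq_zero, zero_mul]
    have hz' : π z ≠ i := fun h => hz (by rw [← hπ z, h, hfix])
    by_cases h1 : z ∈ B
    · simp [word, hAB z h1 hz]
    by_cases h2 : π z ∈ B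
    · have := hAB _ h2 hz'
      rw [hπ] at this
      simp [word, this]
    · simp [word, h1, h2]
  have hA' : π i ∉ A := fun h => hfix (hA h)
  have hB' : π i ∉ B := fun h => hfix (hB h)
  by_cases hz : z = i
  · subst hz
    simp [word, *]
  by_cases hz' : z = π i
  · subst hz'
    simp [word, *, hπ i]
  rw [if_neg (by simp [hz, hz'])]
  have hz'' : π z ≠ i := fun h => hz' (by rw [← h, hπ])
  by_cases h1 : z ∈ B
  · simp [word, hAB z h1 hz]
  by_cases h2 : π z ∈ B
  · have := hAB _ h2 hz''
    rw [hπ] at this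
    simp [word, this]
  · simp [word, h1, h2]

/-- The `Z₂Z₄` structure of a code with avoiding words of weight `k` is unique. -/
lemma structure_unique (hπ : IsStructure π) (hτ : IsStructure τ) (hCπ : ClosedUnderStar π C)
    (hCτ : ClosedUnderStar τ C) (hC : MinDistAtLeast 3 C) {k : ℕ} (hk : 0 < k)
    (hE : HasAvoidingWords k (supports C)) : π = τ := by
  ext1 i
  by_contra hne
  -- `A` avoids `π i` and `τ i`, except where these equal `i`.
  obtain ⟨A, hA, hAk, hiA, hAF⟩ := hE i (({π i, τ i} : Finset (Fin n)).erase i)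
    (Finset.notMem_erase _ _) (by
      have h1 := Finset.card_le_two (a := π i) (b := τ i)
      have h2 := Finset.card_erase_le (s := ({π i, τ i} : Finset (Fin n))) (a := i)
      omega)
  -- The source of the bound `3k` in `HasAvoidingWords`: `(k - 1) + k + k = 3k - 1` points to avoid.
  have hunion : ((A.erase i ∪ A.image π) ∪ A.image τ).card + 1 ≤ 3 * k := by
    have h1 := Finset.card_union_le (A.erase i ∪ A.image π) (A.image τ)
    have h2 := Finset.card_union_le (A.erase i) (A.image π)
    have h3 : (A.image π).card ≤ A.card := Finset.card_image_le
    have h4 : (A.image τ).card ≤ A.card := Finset.card_image_le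
    have h5 := Finset.card_erase_of_mem hiA
    omega
  obtain ⟨B, hB, -, hiB, hBF⟩ := hE i (((A.erase i ∪ A.image π) ∪ A.image τ).erase i)
    (Finset.notMem_erase _ _)
    ((Nat.add_le_add_right Finset.card_erase_le 1).trans hunion)
  rw [Finset.disjoint_left] at hAF hBF
  simp only [Finset.mem_erase, Finset.mem_insert, Finset.mem_singleton, Finset.mem_union,
    not_and, not_or] at hAF hBF
  have key : ∀ ρ : Equiv.Perm (Fin n), IsStructure ρ → (ρ = π ∨ ρ = τ) → ∀ z,
      starOp ρ (word A) (word B) z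
        = word A z + word B z + if ρ i ≠ i ∧ (z = i ∨ z = ρ i) then 1 else 0 := by
    intro ρ hρ hor
    refine starOp_word_apply hρ hiA hiB ?_ ?_ ?_
    · intro h
      by_contra h'
      rcases hor with rfl | rfl
      · exact (hAF h h').1 rfl
      · exact (hAF h h').2 rfl
    · intro h
      by_contra h'
      rcases hor with rfl | rfl
      · exact (hBF h h').1.2 (Finset.mem_image_of_mem _ hiA)
      · exact (hBF h h').2 (Finset.mem_image_of_mem _ hiA)
    · intro z hz hzi
      have h := hBF hz hzi
      refine ⟨h.1.1 hzi, fun hρz => ?_⟩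
      have hmem : z ∈ A.image ρ := Finset.mem_image.2 ⟨ρ z, hρz, hρ z⟩
      rcases hor with rfl | rfl
      · exact h.1.2 hmem
      · exact h.2 hmem
  have hwA := mem_supports.1 hA
  have hwB := mem_supports.1 hB
  -- The products differ at `τ i` if `π` fixes `i`, and at `π i` otherwise.
  have hdiff : starOp π (word A) (word B) ≠ starOp τ (word A) (word B) := by
    intro h
    by_cases hπi : π i = i
    · have h1 := congrFun h (τ i)
      rw [key π hπ (Or.inl rfl), key τ hτ (Or.inr rfl)] at h1
      simp [hπi] at h1
      exact hne (by rw [hπi, h1])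
    · have h1 := congrFun h (π i)
      rw [key π hπ (Or.inl rfl), key τ hτ (Or.inr rfl)] at h1
      simp [hπi, hne] at h1
  have h3 := hC _ (hCπ _ hwA _ hwB) _ (hCτ _ hwA _ hwB) hdiff
  have hex : ∃ a b : Fin n, ∀ z, z ≠ a → z ≠ b →
      starOp π (word A) (word B) z = starOp τ (word A) (word B) z := by
    by_cases hπi : π i = i
    · refine ⟨i, τ i, fun z h1 h2 => ?_⟩
      rw [key π hπ (Or.inl rfl), key τ hτ (Or.inr rfl), if_neg (by simp [hπi]),
        if_neg (by simp [h1, h2])]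
    by_cases hτi : τ i = i
    · refine ⟨i, π i, fun z h1 h2 => ?_⟩
      rw [key π hπ (Or.inl rfl), key τ hτ (Or.inr rfl), if_neg (by simp [h1, h2]),
        if_neg (by simp [hτi])]
    · refine ⟨π i, τ i, fun z h1 h2 => ?_⟩
      rw [key π hπ (Or.inl rfl), key τ hτ (Or.inr rfl)]
      simp [hπi, hτi, h1, h2]
  obtain ⟨a, b, hab⟩ := hex
  have h4 : hammingDist (starOp π (word A) (word B)) (starOp τ (word A) (word B))
      ≤ ({a, b} : Finset (Fin n)).card := by
    refine Finset.card_le_card fun z hz => ?_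
    rw [Finset.mem_filter] at hz
    by_contra h
    simp only [Finset.mem_insert, Finset.mem_singleton, not_or] at h
    exact hz.2 (hab z h.1 h.2)
  have h5 := Finset.card_le_two (a := a) (b := b)
  omega

lemma MinDistAtLeast.mono {d e : ℕ} (hC : MinDistAtLeast d C) (h : e ≤ d) : MinDistAtLeast e C :=
  fun x hx y hy hxy => h.trans (hC x hx y hy hxy)

lemma symGroup_eq_structureSymGroup (hπ : IsStructure π) (hCπ : ClosedUnderStar π C)
    (hC : MinDistAtLeast 3 C) {k : ℕ} (hk : 0 < k) (hE : HasAvoidingWords k (supports C)) :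
    symGroup C = structureSymGroup π C := by
  refine le_antisymm (fun σ hσ => ⟨hσ, fun i => ?_⟩) fun σ hσ => hσ.1
  have hconj : IsStructure (σ * π * σ⁻¹) := fun j => by
    have hππ : ∀ j, π (π j) = j := hπ
    simp [Equiv.Perm.mul_apply, hππ]
  have hinv : σ⁻¹ ∈ symGroup C := inv_mem hσ
  have h := structure_unique hπ hconj hCπ (fun x hx y hy => by
    rw [starOp_conj]
    exact hσ _ (hCπ _ (hinv x hx) _ (hinv y hy))) hC hk hE
  conv_rhs => rw [h]
  simp [Equiv.Perm.mul_apply]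

end Star

end Z2Z4

theorem corollary1 (n : ℕ) (hn : 16 < n) (C : Set (Z2Z4.Word n))
    (hC : Z2Z4.IsOnePerfect C ∨ Z2Z4.IsExtendedOnePerfect C ∨ Z2Z4.IsPreparataLike C)
    (π : Equiv.Perm (Fin n)) (hπ : Z2Z4.IsStructure π)
    (hclosed : Z2Z4.ClosedUnderStar π C) :
    Z2Z4.symGroup C = Z2Z4.structureSymGroup π C := by
  have hne : C.Nonempty := by
    rw [Set.nonempty_iff_ne_empty]
    rintro rfl
    have h1 : ∀ m : ℕ, 0 ≠ 2 ^ m := fun m => (pow_pos two_pos m).ne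
    simp [Z2Z4.IsOnePerfect, Z2Z4.IsExtendedOnePerfect, Z2Z4.IsPreparataLike, h1] at hC
  have h0 : ∅ ∈ Z2Z4.supports C := Z2Z4.mem_supports.2 <| by
    convert Z2Z4.zero_mem_of_closed hπ hclosed hne
    simp [funext_iff, Z2Z4.word]
  rcases hC with h | h | h
  · exact Z2Z4.symGroup_eq_structureSymGroup hπ hclosed h.2 (by norm_num)
      (Z2Z4.hasAvoidingWords_of_perfect hn h0 (by rw [Z2Z4.card_supports, h.1])
        (Z2Z4.separated_supports h.2))
  · exact Z2Z4.symGroup_eq_structureSymGroup hπ hclosed (h.2.mono (by norm_num)) (by norm_num)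
      (Z2Z4.hasAvoidingWords_of_extended hn h0 (by rw [Z2Z4.card_supports, h.1])
        (Z2Z4.separated_supports h.2))
  · exact Z2Z4.symGroup_eq_structureSymGroup hπ hclosed (h.2.mono (by norm_num)) (by norm_num)
      (Z2Z4.hasAvoidingWords_of_preparata hn h0 (by rw [Z2Z4.card_supports, h.1])
        (Z2Z4.separated_supports h.2))
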